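/- For integers $n\ge 1$ and $j\ge 1$, let $H(n,j)$ be the graph with vertex set $\mathbb{Z}_2^n$ in which two vectors are adjacent if and only if their Hamming distance is $j$. A quantum $c$-coloring of a finite graph $G=(V,E)$ consists of an integer $d\ge 1$ and orthogonal projections $P_{v,i}:\mathbb{C}^d\to\mathbb{C}^d$ $(v\in V,\ 1\le i\le c)$ such that $\sum_{i=1}^{c}P_{v,i}=I_d$ for every $v\in V$, and $P_{v,i}P_{w,i}=0$ for all $1\le i\le c$ whenever $v$ and $w$ are adjacent. The quantum chromatic number $\chi_q(G)$ is the smallest $c$ for which $G$ admits a quantum $c$-coloring. Let $h(x)=-x\log_2 x-(1-x)\log_2(1-x)$ for $0<x<1$. (1) For every fixed even integer $j\ge 2$ one has $\chi_q(H(n,j))=\Omega(n^{j/2})$: there are a constant $c>0$ and an integer $N$, depending only on $j$, such that $\chi_q(H(n,j))\ge c\,n^{j/2}$ for all $n\ge N$. (2) There are an absolute constant $c>0$ and an absolute integer $N$ such that for every real $\alpha$ with $0<\alpha\le 0.17$, every $n\ge N$ and every even integer $j$ with $j=\alpha n$, $$\chi_q(H(n,j))\ \ge\ c\left(\frac{2^{h(\alpha)}}{\left(e(1+\sqrt2)\sqrt{(1-\alpha)/\alpha}\right)^{\alpha}}\right)^{n}.$$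 -/

import Mathlib

/-- The binary distance-`j` Hamming graph `H(n, j)`: the vertices are the vectors of `(ℤ/2)ⁿ`, and
two vertices are adjacent iff their Hamming distance is `j`. (The clause `u ≠ v` is automatic for
`0 < j`; it only excludes loops for `j = 0`.) -/
def hammingGraph (n j : ℕ) : SimpleGraph (Fin n → ZMod 2) where
  Adj u v := u ≠ v ∧ hammingDist u v = j
  symm := ⟨fun u v h => ⟨h.1.symm, by rw [hammingDist_comm]; exact h.2⟩⟩
  loopless := ⟨fun _ h => h.1 rfl⟩

/-- A family `P v i` of complex `d × d` matrices is a quantum `c`-coloring of `G` in dimension `d`: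
every `P v i` is an orthogonal projection (a self-adjoint idempotent), `∑ i, P v i = 1` for every
vertex `v`, and `P v i * P w i = 0` for every color `i` whenever `v` and `w` are adjacent. -/
structure IsQuantumColoring {V : Type*} (G : SimpleGraph V) (c d : ℕ)
    (P : V → Fin c → Matrix (Fin d) (Fin d) ℂ) : Prop where
  isStarProjection : ∀ v i, IsStarProjection (P v i)
  sum_eq_one : ∀ v, ∑ i, P v i = 1
  mul_eq_zero : ∀ v w, G.Adj v w → ∀ i, P v i * P w i = 0

/-- `G` admits a quantum `c`-coloring, in some dimension `d ≥ 1`. -/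
def QuantumColorable {V : Type*} (G : SimpleGraph V) (c : ℕ) : Prop :=
  ∃ (d : ℕ) (P : V → Fin c → Matrix (Fin d) (Fin d) ℂ), 0 < d ∧ IsQuantumColoring G c d P

/-- Every classical coloring is a quantum coloring in dimension one. In particular a finite graph
has some quantum coloring. -/
theorem QuantumColorable.of_colorable {V : Type*} {G : SimpleGraph V} {c : ℕ}
    (h : G.Colorable c) : QuantumColorable G c := by
  obtain ⟨C⟩ := h
  refine ⟨1, fun v i => if C v = i then 1 else 0, one_pos, ⟨?_, ?_, ?_⟩⟩
  · intro v i
    split_ifs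
    · exact IsStarProjection.one _
    · exact IsStarProjection.zero _
  · intro v
    simp
  · intro v w hvw i
    have := C.valid hvw
    by_cases h1 : C v = i <;> by_cases h2 : C w = i <;> simp_all

/-- The quantum chromatic number of a finite graph `G`: the smallest `c` such that `G` admits a
quantum `c`-coloring. -/
noncomputable def quantumChromaticNumber {V : Type*} [Finite V] (G : SimpleGraph V) : ℕ :=
  sInf {c : ℕ | QuantumColorable G c}

/-- The binary entropy function (logarithms to base two). -/
noncomputable def binaryEntropy (x : ℝ) : ℝ :=
  -x * Real.logb 2 x - (1 - x) * Real.logb 2 (1 - x)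

/-!
Applying the projections of a quantum coloring to a fixed unit vector gives, for every color,
vectors that are orthogonal along the edges of the graph, so `|V|` divided by the Lovász theta
number bounds the number of colors from below. On a Cayley graph of an abelian group, Parseval's
identity for such vectors yields the Hoffman ratio bound, in terms of a lower bound `-m` for the
character sums over the connection set.

For `H(n, j)` these character sums are the `j`-th elementary symmetric functions of sign vectors
`x`. With `S = ∑ i, x i`, they are nonnegative for even `j` as soon as `S ^ 2 ≥ 4 j (n - j)`,
because the three-term recurrence then keeps the ratios of consecutive terms above
`S / (2 (k + 1))`. For smaller `S`, Cauchy's estimate on the circle of radius `r` for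
`∏ i, (1 + x i z)`, whose modulus is at most `exp (|S| r + n r ^ 2 / 2)` there, bounds them. The
choices `r = 1 / √n` and `r = (√2 - 1) √(j / n)` give the two parts of the theorem.
-/

section ThetaBound

open scoped InnerProductSpace

variable {V : Type*} {G : SimpleGraph V} {θ : ℝ}

/-- The real number `θ` is an upper bound for the Lovász theta number of `G`, in its formulation
through orthogonal representations: vectors `x v` that are orthogonal along the edges of `G`
satisfy `‖∑ v, x v‖ ^ 2 ≤ θ * ∑ v, ‖x v‖ ^ 2`. -/
def IsLovaszThetaBound [Fintype V] (G : SimpleGraph V) (θ : ℝ) : Prop :=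
  ∀ (d : ℕ) (x : V → EuclideanSpace ℂ (Fin d)), (∀ v w, G.Adj v w → ⟪x v, x w⟫_ℂ = 0) →
    ‖∑ v, x v‖ ^ 2 ≤ θ * ∑ v, ‖x v‖ ^ 2

theorem inner_toEuclideanCLM_toEuclideanCLM {d : ℕ} {A : Matrix (Fin d) (Fin d) ℂ}
    (hA : IsSelfAdjoint A) (B : Matrix (Fin d) (Fin d) ℂ) (x y : EuclideanSpace ℂ (Fin d)) :
    ⟪Matrix.toEuclideanCLM (𝕜 := ℂ) A x, Matrix.toEuclideanCLM (𝕜 := ℂ) B y⟫_ℂ =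
      ⟪x, Matrix.toEuclideanCLM (𝕜 := ℂ) (A * B) y⟫_ℂ := by
  rw [map_mul]
  exact (hA.map (Matrix.toEuclideanCLM (𝕜 := ℂ))).isSymmetric x _

theorem norm_sum_sq_le_card_mul_sum_norm_sq {ι E : Type*} [Fintype ι] [SeminormedAddCommGroup E]
    (y : ι → E) : ‖∑ i, y i‖ ^ 2 ≤ Fintype.card ι * ∑ i, ‖y i‖ ^ 2 :=
  calc ‖∑ i, y i‖ ^ 2 ≤ (∑ i, ‖y i‖) ^ 2 := by gcongr; exact norm_sum_le _ _
    _ ≤ Fintype.card ι * ∑ i, ‖y i‖ ^ 2 := sq_sum_le_card_mul_sum_sq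

namespace IsQuantumColoring

variable {c d : ℕ} {P : V → Fin c → Matrix (Fin d) (Fin d) ℂ}

theorem sum_toEuclideanCLM_apply (h : IsQuantumColoring G c d P) (v : V)
    (e : EuclideanSpace ℂ (Fin d)) : ∑ i, Matrix.toEuclideanCLM (𝕜 := ℂ) (P v i) e = e := by
  rw [← sum_apply, ← map_sum, h.sum_eq_one v, map_one,
    one_apply_eq_self]

theorem sum_norm_sq_toEuclideanCLM_apply (h : IsQuantumColoring G c d P) (v : V)
    (e : EuclideanSpace ℂ (Fin d)) :
    ∑ i, ‖Matrix.toEuclideanCLM (𝕜 := ℂ) (P v i) e‖ ^ 2 = ‖e‖ ^ 2 := by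
  have hproj (i : Fin c) : ‖Matrix.toEuclideanCLM (𝕜 := ℂ) (P v i) e‖ ^ 2 =
      RCLike.re ⟪e, Matrix.toEuclideanCLM (𝕜 := ℂ) (P v i) e⟫_ℂ := by
    rw [← inner_self_eq_norm_sq (𝕜 := ℂ), inner_toEuclideanCLM_toEuclideanCLM
      (h.isStarProjection v i).isSelfAdjoint, (h.isStarProjection v i).isIdempotentElem.eq]
  simp only [hproj]
  rw [← map_sum, ← inner_sum, h.sum_toEuclideanCLM_apply, inner_self_eq_norm_sq]

theorem inner_toEuclideanCLM_apply_eq_zero (h : IsQuantumColoring G c d P) {v w : V}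
    (hvw : G.Adj v w) (i : Fin c) (e : EuclideanSpace ℂ (Fin d)) :
    ⟪Matrix.toEuclideanCLM (𝕜 := ℂ) (P v i) e, Matrix.toEuclideanCLM (𝕜 := ℂ) (P w i) e⟫_ℂ = 0 := by
  rw [inner_toEuclideanCLM_toEuclideanCLM (h.isStarProjection v i).isSelfAdjoint,
    h.mul_eq_zero v w hvw i, map_zero, zero_apply, inner_zero_right]

end IsQuantumColoring

theorem IsLovaszThetaBound.card_le_mul_of_quantumColorable [Fintype V] [Nonempty V]
    (hθ : IsLovaszThetaBound G θ) {c : ℕ} (hc : QuantumColorable G c) :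
    (Fintype.card V : ℝ) ≤ θ * c := by
  obtain ⟨d, P, hd, hP⟩ := hc
  set e : EuclideanSpace ℂ (Fin d) := EuclideanSpace.single ⟨0, hd⟩ 1
  have he : ‖e‖ = 1 := by simp [e]
  set x : V → Fin c → EuclideanSpace ℂ (Fin d) :=
    fun v i => Matrix.toEuclideanCLM (𝕜 := ℂ) (P v i) e
  have hcol (i : Fin c) : ‖∑ v, x v i‖ ^ 2 ≤ θ * ∑ v, ‖x v i‖ ^ 2 :=
    hθ d _ fun v w hvw => hP.inner_toEuclideanCLM_apply_eq_zero hvw i e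
  have hsum : ∑ i, ∑ v, x v i = (Fintype.card V : ℂ) • e := by
    rw [Finset.sum_comm]
    simp [x, hP.sum_toEuclideanCLM_apply, Nat.cast_smul_eq_nsmul]
  have hsq : ∑ i, ∑ v, ‖x v i‖ ^ 2 = Fintype.card V := by
    rw [Finset.sum_comm]
    simp [x, hP.sum_norm_sq_toEuclideanCLM_apply, he]
  have hcard : (0 : ℝ) < Fintype.card V := by exact_mod_cast Fintype.card_pos
  refine le_of_mul_le_mul_right ?_ hcard
  calc (Fintype.card V : ℝ) * Fintype.card V = ‖∑ i, ∑ v, x v i‖ ^ 2 := by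
        simp [hsum, norm_smul, he, sq]
    _ ≤ c * ∑ i, ‖∑ v, x v i‖ ^ 2 := by
        simpa using norm_sum_sq_le_card_mul_sum_norm_sq fun i => ∑ v, x v i
    _ ≤ c * ∑ i, θ * ∑ v, ‖x v i‖ ^ 2 := by gcongr with i; exact hcol i
    _ = θ * c * Fintype.card V := by rw [← Finset.mul_sum, hsq]; ring

theorem quantumColorable_quantumChromaticNumber [Finite V] (G : SimpleGraph V) :
    QuantumColorable G (quantumChromaticNumber G) := by
  have := Fintype.ofFinite V
  exact Nat.sInf_mem (s := {c | QuantumColorable G c}) ⟨_, .of_colorable G.colorable_of_fintype⟩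

end ThetaBound

section Cayley

open scoped InnerProductSpace

variable {A : Type*} [AddCommGroup A] [Fintype A]

theorem sum_addChar_mul_norm_sq {E : Type*} [NormedAddCommGroup E] [InnerProductSpace ℂ E]
    (x : A → E) (s : A) :
    ∑ ψ : AddChar A ℂ, ψ s * (‖∑ v, ψ v • x v‖ ^ 2 : ℝ) =
      Fintype.card A * ∑ v, ⟪x (v + s), x v⟫_ℂ := by
  classical
  have hexpand (ψ : AddChar A ℂ) : ψ s * (‖∑ v, ψ v • x v‖ ^ 2 : ℝ) =
      ∑ w, ∑ v, ψ (w + s - v) * ⟪x v, x w⟫_ℂ := by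
    rw [Complex.ofReal_pow, ← Complex.coe_algebraMap, ← inner_self_eq_norm_sq_to_K (𝕜 := ℂ)]
    simp only [inner_sum, sum_inner, inner_smul_left, inner_smul_right, Finset.mul_sum,
      sub_eq_add_neg, AddChar.map_add_eq_mul, AddChar.map_neg_eq_conj]
    exact Finset.sum_congr rfl fun w _ => Finset.sum_congr rfl fun v _ => by ring
  calc ∑ ψ : AddChar A ℂ, ψ s * (‖∑ v, ψ v • x v‖ ^ 2 : ℝ)
      = ∑ w, ∑ v, (∑ ψ : AddChar A ℂ, ψ (w + s - v)) * ⟪x v, x w⟫_ℂ := by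
        simp only [hexpand, Finset.sum_mul]
        rw [Finset.sum_comm]
        exact Finset.sum_congr rfl fun w _ => Finset.sum_comm
    _ = Fintype.card A * ∑ w, ⟪x (w + s), x w⟫_ℂ := by
        simp [AddChar.sum_apply_eq_ite, sub_eq_zero, Finset.mul_sum]

theorem sum_addChar_norm_sq {E : Type*} [NormedAddCommGroup E] [InnerProductSpace ℂ E]
    (x : A → E) :
    ∑ ψ : AddChar A ℂ, ‖∑ v, ψ v • x v‖ ^ 2 = Fintype.card A * ∑ v, ‖x v‖ ^ 2 := by
  have h := sum_addChar_mul_norm_sq x 0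
  simp only [AddChar.map_zero_eq_one, one_mul, add_zero, inner_self_eq_norm_sq_to_K,
    Complex.coe_algebraMap] at h
  exact_mod_cast h

theorem IsLovaszThetaBound.of_addChar {G : SimpleGraph A} {S : Finset A}
    (hS : ∀ v, ∀ s ∈ S, G.Adj (v + s) v) {m : ℝ} (hm : 0 < m)
    (hψ : ∀ ψ : AddChar A ℂ, -m ≤ (∑ s ∈ S, ψ s).re) :
    IsLovaszThetaBound G (m * Fintype.card A / (S.card + m)) := by
  intro d x hx
  have hzero : ∑ ψ : AddChar A ℂ, (∑ s ∈ S, ψ s).re * ‖∑ v, ψ v • x v‖ ^ 2 = 0 := by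
    have h : ∑ ψ : AddChar A ℂ, (∑ s ∈ S, ψ s) * (‖∑ v, ψ v • x v‖ ^ 2 : ℝ) = 0 := by
      simp only [Finset.sum_mul]
      rw [Finset.sum_comm]
      refine Finset.sum_eq_zero fun s hs => ?_
      rw [sum_addChar_mul_norm_sq, Finset.sum_eq_zero fun v _ => hx _ _ (hS v s hs), mul_zero]
    simpa only [Complex.re_sum, Complex.re_mul_ofReal, Complex.zero_re] using congrArg Complex.re h
  rw [div_mul_eq_mul_div, le_div_iff₀ (by positivity)]
  calc ‖∑ v, x v‖ ^ 2 * (S.card + m)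
      = ((∑ s ∈ S, (0 : AddChar A ℂ) s).re + m) * ‖∑ v, (0 : AddChar A ℂ) v • x v‖ ^ 2 := by
        simp [mul_comm]
    _ ≤ ∑ ψ : AddChar A ℂ, ((∑ s ∈ S, ψ s).re + m) * ‖∑ v, ψ v • x v‖ ^ 2 :=
        Finset.single_le_sum
          (f := fun ψ : AddChar A ℂ => ((∑ s ∈ S, ψ s).re + m) * ‖∑ v, ψ v • x v‖ ^ 2)
          (fun ψ _ => mul_nonneg (by linarith [hψ ψ]) (sq_nonneg _)) (Finset.mem_univ 0)
    _ = m * Fintype.card A * ∑ v, ‖x v‖ ^ 2 := by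
        simp only [add_mul, Finset.sum_add_distrib]
        rw [hzero, zero_add, ← Finset.mul_sum, sum_addChar_norm_sq, mul_assoc]

end Cayley

theorem card_add_le_mul_of_quantumColorable {A : Type*} [AddCommGroup A] [Finite A]
    {G : SimpleGraph A} {S : Finset A}
    (hS : ∀ v, ∀ s ∈ S, G.Adj (v + s) v) {m : ℝ} (hm : 0 < m)
    (hψ : ∀ ψ : AddChar A ℂ, -m ≤ (∑ s ∈ S, ψ s).re) {c : ℕ} (hc : QuantumColorable G c) :
    (S.card : ℝ) + m ≤ m * c := by
  have := Fintype.ofFinite A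
  have hcard : (0 : ℝ) < Fintype.card A := by exact_mod_cast Fintype.card_pos
  have h := (IsLovaszThetaBound.of_addChar hS hm hψ).card_le_mul_of_quantumColorable hc
  rw [div_mul_eq_mul_div, le_div_iff₀ (by positivity), mul_right_comm] at h
  exact le_of_mul_le_mul_right ((mul_comm _ _).trans_le h) hcard

section SignVector

open Polynomial

variable {ι R : Type*} [Fintype ι]

/-- The generating polynomial of the elementary symmetric functions of the family `x`. If `x` is a
sign vector of length `n` with `w` entries `-1`, its `k`-th coefficient is the value `K_k(w)` of the
binary Krawtchouk polynomial. -/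
noncomputable def esymmPoly [CommSemiring R] (x : ι → R) : R[X] :=
  ∏ i, (1 + C (x i) * X)

@[simp]
theorem coeff_zero_esymmPoly [CommSemiring R] (x : ι → R) : (esymmPoly x).coeff 0 = 1 := by
  simp [esymmPoly, coeff_zero_eq_eval_zero, eval_prod]

theorem coeff_esymmPoly_neg [CommRing R] (x : ι → R) (k : ℕ) :
    (esymmPoly (-x)).coeff k = (-1) ^ k * (esymmPoly x).coeff k := by
  have h : esymmPoly (-x) = (esymmPoly x).comp (C (-1) * X) := by
    simp [esymmPoly, prod_comp]
  rw [h, comp_C_mul_X_coeff, mul_comm]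

theorem derivative_esymmPoly [CommRing R] [DecidableEq ι] (x : ι → R) :
    derivative (esymmPoly x) = ∑ i, (∏ j ∈ Finset.univ.erase i, (1 + C (x j) * X)) * C (x i) := by
  simp [esymmPoly, derivative_prod_finset]

theorem coeff_one_esymmPoly [CommRing R] (x : ι → R) : (esymmPoly x).coeff 1 = ∑ i, x i := by
  classical
  have h : (derivative (esymmPoly x)).coeff 0 = ∑ i, x i := by
    simp [derivative_esymmPoly, coeff_zero_eq_eval_zero, eval_finsetSum, eval_prod]
  simpa [coeff_derivative] using h

theorem one_sub_X_sq_mul_derivative_esymmPoly [CommRing R] {x : ι → R} (hx : ∀ i, x i ^ 2 = 1) :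
    (1 - X ^ 2) * derivative (esymmPoly x) =
      (C (∑ i, x i) - C (Fintype.card ι : R) * X) * esymmPoly x := by
  classical
  have hi (i : ι) : (1 - X ^ 2) * ((∏ j ∈ Finset.univ.erase i, (1 + C (x j) * X)) * C (x i)) =
      (C (x i) - X) * esymmPoly x := by
    have hC : C (x i) ^ 2 = (1 : R[X]) := by rw [← C_pow, hx, C_1]
    rw [esymmPoly, ← Finset.mul_prod_erase _ _ (Finset.mem_univ i)]
    linear_combination -X * (∏ j ∈ Finset.univ.erase i, (1 + C (x j) * X)) * hC
  rw [derivative_esymmPoly, Finset.mul_sum, Finset.sum_congr rfl fun i _ => hi i, ← Finset.sum_mul,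
    Finset.sum_sub_distrib, map_sum]
  simp

theorem coeff_add_two_esymmPoly [CommRing R] {x : ι → R} (hx : ∀ i, x i ^ 2 = 1) (k : ℕ) :
    ((k : R) + 2) * (esymmPoly x).coeff (k + 2) =
      (∑ i, x i) * (esymmPoly x).coeff (k + 1) - (Fintype.card ι - k) * (esymmPoly x).coeff k := by
  have hX : (X ^ 2 * derivative (esymmPoly x)).coeff (k + 1) = k * (esymmPoly x).coeff k := by
    rw [pow_two, mul_assoc, coeff_X_mul]
    cases k with
    | zero => simp
    | succ k => rw [coeff_X_mul, coeff_derivative]; push_cast; ring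
  have h := congrArg (coeff · (k + 1)) (one_sub_X_sq_mul_derivative_esymmPoly hx)
  simp only [sub_mul, one_mul, coeff_sub, mul_assoc, coeff_C_mul, coeff_X_mul, hX,
    coeff_derivative] at h
  push_cast at h
  linear_combination h

theorem coeff_esymmPoly_ratio_step {x : ι → ℝ} (hx : ∀ i, x i ^ 2 = 1) (hS : 0 < ∑ i, x i)
    {k : ℕ} (hk : k ≤ Fintype.card ι)
    (hkS : 4 * ((k + 1) * ((Fintype.card ι : ℝ) - k)) ≤ (∑ i, x i) ^ 2)
    (hpos : 0 < (esymmPoly x).coeff k)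
    (hratio : (∑ i, x i) / 2 * (esymmPoly x).coeff k ≤ (k + 1) * (esymmPoly x).coeff (k + 1)) :
    0 < (esymmPoly x).coeff (k + 1) ∧
      (∑ i, x i) / 2 * (esymmPoly x).coeff (k + 1) ≤ (k + 2) * (esymmPoly x).coeff (k + 2) := by
  rw [coeff_add_two_esymmPoly hx]
  set S := ∑ i, x i
  set a := (esymmPoly x).coeff
  have hnk : (0 : ℝ) ≤ Fintype.card ι - k := sub_nonneg.2 (by exact_mod_cast hk)
  have hpos' : 0 < a (k + 1) := by
    have : 0 < ((k : ℝ) + 1) * a (k + 1) := lt_of_lt_of_le (by positivity) hratio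
    exact pos_of_mul_pos_right this (by positivity)
  refine ⟨hpos', ?_⟩
  have hmul : S / 2 * ((Fintype.card ι - k) * a k) ≤ S / 2 * (S / 2 * a (k + 1)) :=
    calc S / 2 * ((Fintype.card ι - k) * a k) = (Fintype.card ι - k) * (S / 2 * a k) := by ring
      _ ≤ (Fintype.card ι - k) * ((k + 1) * a (k + 1)) := by gcongr
      _ = 4 * ((k + 1) * (Fintype.card ι - k)) * a (k + 1) / 4 := by ring
      _ ≤ S ^ 2 * a (k + 1) / 4 := by gcongr
      _ = S / 2 * (S / 2 * a (k + 1)) := by ring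
  linarith [le_of_mul_le_mul_left hmul (by positivity)]

theorem coeff_esymmPoly_pos_and_ratio {x : ι → ℝ} (hx : ∀ i, x i ^ 2 = 1) (hS : 0 < ∑ i, x i)
    {j : ℕ} (hj : 3 * j ≤ Fintype.card ι + 2)
    (hjS : 4 * (j * ((Fintype.card ι : ℝ) - j)) ≤ (∑ i, x i) ^ 2) {k : ℕ} (hk : k < j) :
    0 < (esymmPoly x).coeff k ∧
      (∑ i, x i) / 2 * (esymmPoly x).coeff k ≤ (k + 1) * (esymmPoly x).coeff (k + 1) := by
  induction k with
  | zero => simpa [coeff_one_esymmPoly] using hS.le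
  | succ k ih =>
    obtain ⟨hpos, hratio⟩ := ih (by omega)
    have hj' : (3 : ℝ) * j ≤ Fintype.card ι + 2 := by exact_mod_cast hj
    have hk' : (k : ℝ) + 2 ≤ j := by exact_mod_cast hk
    have hmono : ((k : ℝ) + 1) * (Fintype.card ι - k) ≤ j * (Fintype.card ι - j) := by
      have : (0 : ℝ) ≤ (j - (k + 2)) * (Fintype.card ι - j - (k + 1)) :=
        mul_nonneg (by linarith) (by linarith [k.cast_nonneg (α := ℝ)])
      linarith
    have h := coeff_esymmPoly_ratio_step hx hS (by omega) (by linarith) hpos hratio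
    refine ⟨h.1, h.2.trans_eq ?_⟩
    push_cast
    ring

theorem coeff_esymmPoly_pos {x : ι → ℝ} (hx : ∀ i, x i ^ 2 = 1) (hS : 0 < ∑ i, x i)
    {j : ℕ} (hj : 3 * j ≤ Fintype.card ι + 2)
    (hjS : 4 * (j * ((Fintype.card ι : ℝ) - j)) ≤ (∑ i, x i) ^ 2) :
    0 < (esymmPoly x).coeff j := by
  cases j with
  | zero => simp
  | succ k =>
    obtain ⟨hpos, hratio⟩ := coeff_esymmPoly_pos_and_ratio hx hS hj hjS k.lt_succ_self
    exact pos_of_mul_pos_right (lt_of_lt_of_le (by positivity) hratio) (by positivity)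

theorem coeff_esymmPoly_nonneg {x : ι → ℝ} (hx : ∀ i, x i ^ 2 = 1) {j : ℕ} (hje : Even j)
    (hj : 3 * j ≤ Fintype.card ι + 2)
    (hjS : 4 * (j * ((Fintype.card ι : ℝ) - j)) ≤ (∑ i, x i) ^ 2) :
    0 ≤ (esymmPoly x).coeff j := by
  rcases lt_trichotomy (∑ i, x i) 0 with hS | hS | hS
  · have h : 0 < (esymmPoly (-x)).coeff j :=
      coeff_esymmPoly_pos (by simpa using hx) (by simpa using hS) hj (by simpa using hjS)
    simpa [coeff_esymmPoly_neg, hje.neg_one_pow] using h.le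
  · obtain rfl : j = 0 := by
      by_contra hj0
      have h1 : (2 : ℝ) ≤ j := by exact_mod_cast (by obtain ⟨i, rfl⟩ := hje; omega : 2 ≤ j)
      have h2 : (3 : ℝ) * j ≤ Fintype.card ι + 2 := by exact_mod_cast hj
      have h3 : (0 : ℝ) < j * (Fintype.card ι - j) := mul_pos (by linarith) (by linarith)
      rw [hS] at hjS
      linarith
    simp
  · exact (coeff_esymmPoly_pos hx hS hj hjS).le

theorem norm_coeff_le_of_forall_mem_sphere_norm_le {p : ℂ[X]} {r M : ℝ} (hr : 0 < r)
    (hM : ∀ z ∈ Metric.sphere (0 : ℂ) r, ‖p.eval z‖ ≤ M) (k : ℕ) : ‖p.coeff k‖ ≤ M / r ^ k := by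
  have hderiv : iteratedDeriv k p.eval 0 = k.factorial * p.coeff k := by
    have h : iteratedDeriv k p.eval = (derivative^[k] p).eval := by
      induction k with
      | zero => simp
      | succ k ih => rw [iteratedDeriv_succ, ih, Function.iterate_succ_apply']; ext; simp
    simp only [h, ← coeff_zero_eq_eval_zero, coeff_iterate_derivative]
    simp [Nat.descFactorial_self]
  have h := Complex.norm_iteratedDeriv_le_of_forall_mem_sphere_norm_le k hr
    p.differentiable.diffContOnCl hM
  rw [hderiv, norm_mul, Complex.norm_natCast, mul_div_assoc] at h
  exact le_of_mul_le_mul_left h (by positivity)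

theorem norm_one_add_ofReal_mul_sq_le (x : ℝ) (z : ℂ) :
    ‖1 + x * z‖ ^ 2 ≤ Real.exp (2 * x * z.re + x ^ 2 * ‖z‖ ^ 2) := by
  calc ‖1 + x * z‖ ^ 2 = 2 * x * z.re + x ^ 2 * ‖z‖ ^ 2 + 1 := by
        simp only [Complex.sq_norm, Complex.normSq_apply]
        simp
        ring
    _ ≤ _ := Real.add_one_le_exp _

theorem norm_prod_one_add_ofReal_mul_le (x : ι → ℝ) (z : ℂ) :
    ‖∏ i, (1 + x i * z)‖ ≤ Real.exp (|∑ i, x i| * ‖z‖ + (∑ i, x i ^ 2) * ‖z‖ ^ 2 / 2) := by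
  refine le_of_sq_le_sq ?_ (Real.exp_pos _).le
  calc ‖∏ i, (1 + x i * z)‖ ^ 2 = ∏ i, ‖1 + x i * z‖ ^ 2 := by
        rw [norm_prod, Finset.prod_pow]
    _ ≤ ∏ i, Real.exp (2 * x i * z.re + x i ^ 2 * ‖z‖ ^ 2) := by
        gcongr with i; exact norm_one_add_ofReal_mul_sq_le _ _
    _ = Real.exp (2 * ((∑ i, x i) * z.re) + (∑ i, x i ^ 2) * ‖z‖ ^ 2) := by
        rw [← Real.exp_sum, Finset.sum_add_distrib, ← Finset.sum_mul, ← Finset.sum_mul,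
          ← Finset.mul_sum, mul_assoc]
    _ ≤ Real.exp (2 * (|∑ i, x i| * ‖z‖) + (∑ i, x i ^ 2) * ‖z‖ ^ 2) := by
        gcongr Real.exp (2 * ?_ + _)
        refine (le_abs_self _).trans ?_
        rw [abs_mul]
        gcongr
        exact z.abs_re_le_norm
    _ = Real.exp (|∑ i, x i| * ‖z‖ + (∑ i, x i ^ 2) * ‖z‖ ^ 2 / 2) ^ 2 := by
        rw [← Real.exp_nat_mul]; congr 1; push_cast; ring

theorem abs_coeff_esymmPoly_le (x : ι → ℝ) {r : ℝ} (hr : 0 < r) (k : ℕ) :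
    |(esymmPoly x).coeff k| ≤
      Real.exp (|∑ i, x i| * r + (∑ i, x i ^ 2) * r ^ 2 / 2) / r ^ k := by
  have hM (z : ℂ) (hz : z ∈ Metric.sphere 0 r) : ‖((esymmPoly x).map Complex.ofRealHom).eval z‖ ≤
      Real.exp (|∑ i, x i| * r + (∑ i, x i ^ 2) * r ^ 2 / 2) := by
    rw [mem_sphere_zero_iff_norm] at hz
    simpa [esymmPoly, Polynomial.map_prod, eval_prod, hz] using norm_prod_one_add_ofReal_mul_le x z
  simpa [coeff_map] using norm_coeff_le_of_forall_mem_sphere_norm_le hr hM k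

theorem neg_le_coeff_esymmPoly {x : ι → ℝ} (hx : ∀ i, x i ^ 2 = 1) {j : ℕ} (hje : Even j)
    (hj : 3 * j ≤ Fintype.card ι + 2) {r : ℝ} (hr : 0 < r) :
    -(Real.exp (2 * √(j * ((Fintype.card ι : ℝ) - j)) * r + Fintype.card ι * r ^ 2 / 2) / r ^ j) ≤
      (esymmPoly x).coeff j := by
  rcases le_total (4 * (j * ((Fintype.card ι : ℝ) - j))) ((∑ i, x i) ^ 2) with hS | hS
  · exact (neg_nonpos.2 (by positivity)).trans (coeff_esymmPoly_nonneg hx hje hj hS)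
  · have hS' : |∑ i, x i| ≤ 2 * √(j * ((Fintype.card ι : ℝ) - j)) := by
      rw [← Real.sqrt_sq_eq_abs]
      refine Real.sqrt_le_iff.2 ⟨by positivity, ?_⟩
      rw [mul_pow, Real.sq_sqrt (by nlinarith [sq_nonneg (∑ i, x i)])]
      linarith
    refine neg_le_of_abs_le ((abs_coeff_esymmPoly_le x hr j).trans ?_)
    simp only [hx, Finset.sum_const, Finset.card_univ, nsmul_eq_mul, mul_one]
    gcongr

end SignVector

theorem addChar_sum_eq_prod {A M κ : Type*} [AddCommMonoid A] [CommMonoid M] (ψ : AddChar A M)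
    (s : Finset κ) (f : κ → A) : ψ (∑ i ∈ s, f i) = ∏ i ∈ s, ψ (f i) :=
  map_prod ψ.toMonoidHom (fun i => Multiplicative.ofAdd (f i)) s

section Hamming

open Polynomial

variable {ι : Type*} [Fintype ι] [DecidableEq ι]

theorem sum_addChar_mul_X_pow_hammingNorm {R : Type*} [CommRing R] (ψ : AddChar (ι → ZMod 2) R) :
    ∑ t, C (ψ t) * X ^ hammingNorm t = esymmPoly fun i => ψ (Pi.single i 1) := by
  have hψ (t : ι → ZMod 2) : ψ t = ∏ i, ψ (Pi.single i (t i)) := by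
    rw [← addChar_sum_eq_prod, Finset.univ_sum_single]
  have hfactor (i : ι) : ∑ a : ZMod 2, C (ψ (Pi.single i a)) * (if a = 0 then 1 else X) =
      1 + C (ψ (Pi.single i 1)) * X := by
    rw [show (Finset.univ : Finset (ZMod 2)) = {0, 1} from rfl, Finset.sum_pair zero_ne_one]
    simp
  simp only [esymmPoly, ← hfactor, Finset.prod_univ_sum, Fintype.piFinset_univ]
  refine Finset.sum_congr rfl fun t _ => ?_
  rw [Finset.prod_mul_distrib, ← map_prod, ← hψ]
  simp [hammingNorm, Finset.prod_ite]

theorem sum_addChar_hammingNorm_eq {R : Type*} [CommRing R] (ψ : AddChar (ι → ZMod 2) R) (j : ℕ) :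
    ∑ t with hammingNorm t = j, ψ t = (esymmPoly fun i => ψ (Pi.single i 1)).coeff j := by
  simp [← sum_addChar_mul_X_pow_hammingNorm, finsetSum_coeff, coeff_X_pow, Finset.sum_filter,
    eq_comm]

theorem card_filter_hammingNorm_eq (j : ℕ) :
    (Finset.univ.filter fun t : ι → ZMod 2 => hammingNorm t = j).card =
      (Fintype.card ι).choose j := by
  have h := sum_addChar_hammingNorm_eq (1 : AddChar (ι → ZMod 2) ℤ) j
  simp only [AddChar.one_apply, esymmPoly, map_one, one_mul, Finset.prod_const, Finset.card_univ,
    coeff_one_add_X_pow, Finset.sum_const, nsmul_eq_mul, mul_one] at h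
  exact_mod_cast h

theorem exists_sum_addChar_hammingNorm_eq_coeff_esymmPoly (ψ : AddChar (ι → ZMod 2) ℂ) :
    ∃ x : ι → ℝ, (∀ i, x i ^ 2 = 1) ∧
      ∀ j, ∑ t with hammingNorm t = j, ψ t = ((esymmPoly x).coeff j : ℂ) := by
  have hsign (i : ι) : ∃ y : ℝ, y ^ 2 = 1 ∧ ψ (Pi.single i 1) = y := by
    have hsq : ψ (Pi.single i 1) ^ 2 = 1 := by
      rw [← AddChar.map_nsmul_eq_pow, two_nsmul, ← Pi.single_add, CharTwo.add_self_eq_zero,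
        Pi.single_zero, AddChar.map_zero_eq_one]
    rcases sq_eq_one_iff.1 hsq with h | h
    · exact ⟨1, by norm_num, by simpa using h⟩
    · exact ⟨-1, by norm_num, by simpa using h⟩
  choose x hx hψx using hsign
  refine ⟨x, hx, fun j => ?_⟩
  have hmap : esymmPoly (fun i => ψ (Pi.single i 1)) = (esymmPoly x).map Complex.ofRealHom := by
    simp [esymmPoly, Polynomial.map_prod, hψx]
  rw [sum_addChar_hammingNorm_eq, hmap, coeff_map, Complex.ofRealHom_eq_coe]

end Hamming

theorem hammingGraph_adj_add_left {n j : ℕ} (hj : 0 < j) (v : Fin n → ZMod 2)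
    {t : Fin n → ZMod 2} (ht : hammingNorm t = j) : (hammingGraph n j).Adj (v + t) v := by
  refine ⟨fun h => ?_, by rwa [hammingDist_comm, hammingDist_eq_hammingNorm, neg_add_cancel_left]⟩
  rw [add_eq_left.1 h, hammingNorm_zero] at ht
  omega

theorem choose_mul_pow_le_quantumChromaticNumber_mul_exp {n j : ℕ} (hj0 : 0 < j) (hje : Even j)
    (hj : 3 * j ≤ n + 2) {r : ℝ} (hr : 0 < r) :
    n.choose j * r ^ j ≤ quantumChromaticNumber (hammingGraph n j) *
      Real.exp (2 * √(j * ((n : ℝ) - j)) * r + n * r ^ 2 / 2) := by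
  set m : ℝ := Real.exp (2 * √(j * ((n : ℝ) - j)) * r + n * r ^ 2 / 2) / r ^ j with hm
  have hm0 : 0 < m := by positivity
  have hψ (ψ : AddChar (Fin n → ZMod 2) ℂ) : -m ≤ (∑ t with hammingNorm t = j, ψ t).re := by
    obtain ⟨x, hx, hψx⟩ := exists_sum_addChar_hammingNorm_eq_coeff_esymmPoly ψ
    rw [hψx, Complex.ofReal_re]
    simpa only [Fintype.card_fin] using neg_le_coeff_esymmPoly hx hje (by simpa using hj) hr
  have h := card_add_le_mul_of_quantumColorable
    (fun v t ht => hammingGraph_adj_add_left hj0 v (Finset.mem_filter.1 ht).2) hm0 hψ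
    (quantumColorable_quantumChromaticNumber _)
  rw [card_filter_hammingNorm_eq, Fintype.card_fin] at h
  rw [← le_div_iff₀ (by positivity), mul_div_assoc, ← hm]
  linarith

theorem div_two_pow_div_factorial_le_choose {n k : ℕ} (h : 2 * k ≤ n + 2) :
    ((n : ℝ) / 2) ^ k / k.factorial ≤ n.choose k := by
  refine le_trans ?_ (Nat.pow_le_choose k n)
  gcongr
  rw [div_le_iff₀ two_pos]
  exact_mod_cast (by omega : n ≤ (n + 1 - k) * 2)

theorem sqrt_pow_of_even {x : ℝ} (hx : 0 ≤ x) {j : ℕ} (hj : Even j) : √x ^ j = x ^ (j / 2) := by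
  obtain ⟨i, rfl⟩ := hj
  rw [← two_mul, pow_mul, Real.sq_sqrt hx, Nat.mul_div_cancel_left _ two_pos]

theorem mul_pow_le_quantumChromaticNumber_hammingGraph {n j : ℕ} (hj0 : 0 < j) (hje : Even j)
    (hn : 3 * j ≤ n) :
    (2 ^ j * j.factorial * Real.exp (2 * √j + 1 / 2))⁻¹ * (n : ℝ) ^ (j / 2) ≤
      quantumChromaticNumber (hammingGraph n j) := by
  have hn0 : (0 : ℝ) < n := by exact_mod_cast (by omega : 0 < n)
  have hbound := choose_mul_pow_le_quantumChromaticNumber_mul_exp hj0 hje (n := n) (by omega)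
    (r := (√n)⁻¹) (by positivity)
  have hexp : 2 * √(j * ((n : ℝ) - j)) * (√n)⁻¹ + n * (√n)⁻¹ ^ 2 / 2 ≤ 2 * √j + 1 / 2 := by
    have hsqrt : √(j * ((n : ℝ) - j)) ≤ √j * √n := by
      rw [← Real.sqrt_mul (by positivity)]
      gcongr
      linarith [j.cast_nonneg (α := ℝ)]
    rw [inv_pow, Real.sq_sqrt hn0.le, mul_inv_cancel₀ hn0.ne', mul_assoc]
    gcongr
    rwa [← div_eq_mul_inv, div_le_iff₀ (by positivity)]
  rw [inv_mul_le_iff₀ (by positivity)]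
  calc (n : ℝ) ^ (j / 2)
      = 2 ^ j * j.factorial * ((n / 2) ^ j / j.factorial * (√n)⁻¹ ^ j) := by
        rw [inv_pow, div_pow, ← sqrt_pow_of_even hn0.le hje]
        field_simp
        rw [← pow_mul, mul_comm j 2, pow_mul, Real.sq_sqrt hn0.le]
    _ ≤ 2 ^ j * j.factorial * (n.choose j * (√n)⁻¹ ^ j) := by
        gcongr
        exact div_two_pow_div_factorial_le_choose (by omega)
    _ ≤ 2 ^ j * j.factorial *
          (quantumChromaticNumber (hammingGraph n j) * Real.exp (2 * √j + 1 / 2)) := by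
        refine mul_le_mul_of_nonneg_left (hbound.trans ?_) (by positivity)
        gcongr
    _ = _ := by ring

theorem factorial_le_exp_one_mul_sqrt_mul_pow {n : ℕ} (hn : 0 < n) :
    (n.factorial : ℝ) ≤ Real.exp 1 * √n * (n / Real.exp 1) ^ n := by
  obtain ⟨k, rfl⟩ := Nat.exists_eq_add_one.2 hn
  have h := Stirling.stirlingSeq'_antitone (Nat.zero_le k)
  simp only [Function.comp, Nat.succ_eq_add_one, zero_add] at h
  rw [Stirling.stirlingSeq_one, Stirling.stirlingSeq, div_le_iff₀ (by positivity)] at h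
  refine h.trans_eq ?_
  rw [Real.sqrt_mul (by norm_num)]
  field_simp

theorem sqrt_mul_pow_le_factorial (n : ℕ) :
    √n * (n / Real.exp 1) ^ n ≤ n.factorial := by
  refine le_trans ?_ (Stirling.le_factorial_stirling n)
  gcongr
  nlinarith [Real.pi_gt_three, n.cast_nonneg (α := ℝ)]

theorem add_pow_add_le_choose_mul {j k : ℕ} (hj : 0 < j) (hk : 0 < k) :
    ((j + k : ℕ) : ℝ) ^ (j + k) ≤
      Real.exp 1 ^ 2 * √j * (j + k).choose j * ((j : ℝ) ^ j * (k : ℝ) ^ k) := by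
  have hk' : 0 < √(k : ℝ) := Real.sqrt_pos.2 (by exact_mod_cast hk)
  have hfactorial : √k * (((j + k : ℕ) : ℝ) / Real.exp 1) ^ (j + k) ≤
      (j + k).choose j * (Real.exp 1 * √j * (j / Real.exp 1) ^ j) *
        (Real.exp 1 * √k * (k / Real.exp 1) ^ k) :=
    calc √k * (((j + k : ℕ) : ℝ) / Real.exp 1) ^ (j + k)
        ≤ √(j + k : ℕ) * (((j + k : ℕ) : ℝ) / Real.exp 1) ^ (j + k) := by
          gcongr
          exact Nat.le_add_left k j
      _ ≤ (j + k).factorial := sqrt_mul_pow_le_factorial _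
      _ = (j + k).choose j * j.factorial * k.factorial := by
          rw [Nat.choose_symm_add]
          exact_mod_cast (Nat.add_choose_mul_factorial_mul_factorial j k).symm
      _ ≤ _ := by
          gcongr
          · exact factorial_le_exp_one_mul_sqrt_mul_pow hj
          · exact factorial_le_exp_one_mul_sqrt_mul_pow hk
  rw [div_pow, div_pow, div_pow, pow_add (Real.exp 1)] at hfactorial
  field_simp at hfactorial
  linarith

theorem two_rpow_binaryEntropy (x : ℝ) :
    (2 : ℝ) ^ binaryEntropy x = Real.exp (Real.binEntropy x) := by
  have hlog : Real.log 2 ≠ 0 := (Real.log_pos one_lt_two).ne'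
  rw [Real.rpow_def_of_pos two_pos, binaryEntropy, Real.binEntropy, Real.logb, Real.logb,
    Real.log_inv, Real.log_inv]
  congr 1
  field_simp
  ring

theorem exp_binEntropy_pow_mul {j k : ℕ} (hj : 0 < j) (hk : 0 < k) :
    Real.exp (Real.binEntropy (j / (j + k : ℕ))) ^ (j + k) * ((j : ℝ) ^ j * (k : ℝ) ^ k) =
      ((j + k : ℕ) : ℝ) ^ (j + k) := by
  have hj' : (0 : ℝ) < j := by exact_mod_cast hj
  have hk' : (0 : ℝ) < k := by exact_mod_cast hk
  have hcompl : 1 - (j : ℝ) / (j + k : ℕ) = k / (j + k : ℕ) := by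
    push_cast
    field_simp
    ring
  have hent : ((j + k : ℕ) : ℝ) * Real.binEntropy (j / (j + k : ℕ)) =
      (j + k : ℕ) * Real.log (j + k : ℕ) - j * Real.log j - k * Real.log k := by
    rw [Real.binEntropy, hcompl, Real.log_inv, Real.log_inv, Real.log_div hj'.ne' (by positivity),
      Real.log_div hk'.ne' (by positivity)]
    field_simp
    push_cast
    ring
  rw [← Real.exp_nat_mul, hent, Real.exp_sub, Real.exp_sub]
  simp only [Real.exp_nat_mul]
  rw [Real.exp_log (by positivity), Real.exp_log hj', Real.exp_log hk']
  field_simp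

theorem two_rpow_binaryEntropy_pow_le {n j : ℕ} (hj : 0 < j) (hjn : j < n) :
    ((2 : ℝ) ^ binaryEntropy (j / n)) ^ n ≤ Real.exp 1 ^ 2 * √j * n.choose j := by
  obtain ⟨k, rfl⟩ := Nat.exists_eq_add_of_le hjn.le
  have hk : 0 < k := by omega
  have hpos : (0 : ℝ) < (j : ℝ) ^ j * (k : ℝ) ^ k := by positivity
  refine le_of_mul_le_mul_right ?_ hpos
  rw [two_rpow_binaryEntropy, exp_binEntropy_pow_mul hj hk]
  exact add_pow_add_le_choose_mul hj hk

theorem exp_add_sq_div_two_le_exp_one_mul {y : ℝ} (hy : 0.9 ≤ y) (hy1 : y ≤ 1) :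
    Real.exp (2 * (√2 - 1) * y + (√2 - 1) ^ 2 / 2) ≤
      Real.exp 1 * y * Real.exp (-(1 / 20)) := by
  have hy0 : 0 < y := by linarith
  have hsqrt_lt : √2 ≤ (1.41422 : ℝ) := Real.sqrt_le_iff.2 (by norm_num)
  have hsqrt_gt : (1.4142 : ℝ) ≤ √2 := Real.le_sqrt_of_sq_le (by norm_num)
  have hlinear : 2 * (√2 - 1) * y ≤ 0.82844 * y := by gcongr; linarith
  have hconst : (√2 - 1) ^ 2 / 2 ≤ 0.0859 := by nlinarith
  have hinv : y⁻¹ ≤ 1.8641 - 0.82844 * y := by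
    rw [inv_le_iff_one_le_mul₀ hy0]
    nlinarith [mul_nonneg (sub_nonneg.2 hy) (sub_nonneg.2 hy1)]
  have hlog := Real.one_sub_inv_le_log_of_pos hy0
  calc Real.exp (2 * (√2 - 1) * y + (√2 - 1) ^ 2 / 2)
      ≤ Real.exp (1 + Real.log y + -(1 / 20)) := Real.exp_le_exp.2 (by linarith)
    _ = _ := by rw [Real.exp_add, Real.exp_add, Real.exp_log hy0]

theorem sqrt_mul_exp_neg_pow_le (j : ℕ) : √(j : ℝ) * Real.exp (-(1 / 20)) ^ j ≤ 20 := by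
  rw [← Real.exp_nat_mul, mul_neg, Real.exp_neg, ← div_eq_mul_inv, div_le_iff₀ (Real.exp_pos _)]
  have hexp := Real.add_one_le_exp ((j : ℝ) * (1 / 20))
  have hsqrt : √(j : ℝ) ≤ 1 + j := Real.sqrt_le_iff.2 ⟨by positivity, by nlinarith⟩
  linarith

theorem choose_mul_pow_le_quantumChromaticNumber_mul_exp_pow {n j : ℕ} (hj0 : 0 < j)
    (hje : Even j) (hj : 3 * j ≤ n + 2) {α t : ℝ} (ht : 0 < t) (hα : (j : ℝ) = α * n) :
    n.choose j * (t * √α) ^ j ≤ quantumChromaticNumber (hammingGraph n j) *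
      Real.exp (2 * t * √(1 - α) + t ^ 2 / 2) ^ j := by
  have hα0 : 0 < α := pos_of_mul_pos_left (hα ▸ Nat.cast_pos.2 hj0) n.cast_nonneg
  have h := choose_mul_pow_le_quantumChromaticNumber_mul_exp hj0 hje hj (r := t * √α)
    (by positivity)
  refine h.trans_eq ?_
  have hvar : (j : ℝ) * (n - j) = (n * √α) ^ 2 * (1 - α) := by
    rw [mul_pow, Real.sq_sqrt hα0.le, hα]; ring
  rw [← Real.exp_nat_mul, hvar, Real.sqrt_mul (by positivity), Real.sqrt_sq (by positivity), hα]
  congr 2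
  linear_combination (2 * n * √(1 - α) * t + n * t ^ 2 / 2) * Real.sq_sqrt hα0.le

theorem exp_mul_sqrt_rpow_pow {n j : ℕ} {α : ℝ} (h0 : 0 < α) (h1 : α < 1)
    (hα : (j : ℝ) = α * n) :
    ((Real.exp 1 * (1 + √2) * √((1 - α) / α)) ^ α) ^ n =
      (Real.exp 1 * √(1 - α)) ^ j / ((√2 - 1) * √α) ^ j := by
  have hsqrt : (1 : ℝ) < √2 := Real.lt_sqrt_of_sq_lt (by norm_num)
  have hα0 : 0 < √α := Real.sqrt_pos.2 h0
  have hsub : 0 < √2 - 1 := sub_pos.2 hsqrt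
  rw [← Real.rpow_mul_natCast (by positivity), ← hα, Real.rpow_natCast, ← div_pow,
    Real.sqrt_div (sub_pos.2 h1).le]
  congr 1
  rw [eq_div_iff (mul_pos hsub hα0).ne']
  field_simp
  linear_combination √(1 - α) * Real.sq_sqrt (zero_le_two (α := ℝ))

theorem mul_binaryEntropy_pow_le_quantumChromaticNumber_hammingGraph {α : ℝ} (h0 : 0 < α)
    (h1 : α ≤ 0.17) {n j : ℕ} (hn : 1 ≤ n) (hje : Even j) (hα : (j : ℝ) = α * n) :
    (20 * Real.exp 1 ^ 2)⁻¹ * ((2 : ℝ) ^ binaryEntropy α /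
        (Real.exp 1 * (1 + √2) * √((1 - α) / α)) ^ α) ^ n ≤
      quantumChromaticNumber (hammingGraph n j) := by
  have hn' : (1 : ℝ) ≤ n := by exact_mod_cast hn
  have hj0 : 0 < j := by
    have : (0 : ℝ) < j := by rw [hα]; positivity
    exact_mod_cast this
  have hjn : 3 * j ≤ n := by
    have : 3 * (j : ℝ) ≤ n := by rw [hα]; nlinarith
    exact_mod_cast this
  have ht : 0 < √2 - 1 := sub_pos.2 (Real.lt_sqrt_of_sq_lt (by norm_num))
  have hy : 0.9 ≤ √(1 - α) := Real.le_sqrt_of_sq_le (by linarith)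
  have hy0 : 0 < √(1 - α) := by linarith
  have hentropy : ((2 : ℝ) ^ binaryEntropy α) ^ n ≤ Real.exp 1 ^ 2 * √j * n.choose j := by
    rw [(by rw [hα]; field_simp : α = j / n)]
    exact two_rpow_binaryEntropy_pow_le hj0 (by omega)
  have hbound := choose_mul_pow_le_quantumChromaticNumber_mul_exp_pow hj0 hje (by omega) ht hα
  have hexp := exp_add_sq_div_two_le_exp_one_mul hy (Real.sqrt_le_one.2 (by linarith))
  set q := quantumChromaticNumber (hammingGraph n j)
  rw [div_pow, exp_mul_sqrt_rpow_pow h0 (by linarith) hα, div_div_eq_mul_div,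
    inv_mul_le_iff₀ (by positivity), div_le_iff₀ (pow_pos (mul_pos (Real.exp_pos 1) hy0) j)]
  calc ((2 : ℝ) ^ binaryEntropy α) ^ n * ((√2 - 1) * √α) ^ j
      ≤ Real.exp 1 ^ 2 * √j * n.choose j * ((√2 - 1) * √α) ^ j := by gcongr
    _ = Real.exp 1 ^ 2 * √j * (n.choose j * ((√2 - 1) * √α) ^ j) := by ring
    _ ≤ Real.exp 1 ^ 2 * √j * (q * (Real.exp 1 * √(1 - α) * Real.exp (-(1 / 20))) ^ j) := by
        refine mul_le_mul_of_nonneg_left (hbound.trans ?_) (by positivity)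
        gcongr
    _ = Real.exp 1 ^ 2 * q * (Real.exp 1 * √(1 - α)) ^ j * (√j * Real.exp (-(1 / 20)) ^ j) := by
        rw [mul_pow (Real.exp 1 * √(1 - α))]; ring
    _ ≤ Real.exp 1 ^ 2 * q * (Real.exp 1 * √(1 - α)) ^ j * 20 := by
        gcongr
        exact sqrt_mul_exp_neg_pow_le j
    _ = 20 * Real.exp 1 ^ 2 * q * (Real.exp 1 * √(1 - α)) ^ j := by ring

theorem mainTheorem4 :
    (∀ j : ℕ, 0 < j → Even j →
      ∃ c : ℝ, 0 < c ∧ ∃ N : ℕ, ∀ n : ℕ, N ≤ n →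
        c * (n : ℝ) ^ (j / 2) ≤ (quantumChromaticNumber (hammingGraph n j) : ℝ)) ∧
    (∃ c : ℝ, 0 < c ∧ ∃ N : ℕ, ∀ α : ℝ, 0 < α → α ≤ 0.17 →
      ∀ n j : ℕ, N ≤ n → Even j → (j : ℝ) = α * (n : ℝ) →
        c * ((2 : ℝ) ^ binaryEntropy α /
              (Real.exp 1 * (1 + Real.sqrt 2) * Real.sqrt ((1 - α) / α)) ^ α) ^ n
          ≤ (quantumChromaticNumber (hammingGraph n j) : ℝ)) := by
  exact
    ⟨fun j hj0 hje => ⟨(2 ^ j * j.factorial * Real.exp (2 * √j + 1 / 2))⁻¹, by positivity, 3 * j,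
      fun _ hn => mul_pow_le_quantumChromaticNumber_hammingGraph hj0 hje hn⟩,
    (20 * Real.exp 1 ^ 2)⁻¹, by positivity, 1, fun _ h0 h1 _ _ hn hje hα =>
      mul_binaryEntropy_pow_le_quantumChromaticNumber_hammingGraph h0 h1 hn hje hα⟩
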